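/- Let $(X,d)$ be a metric space, let $\phi:X\to(-\infty,+\infty]$ be lower semicontinuous and proper, i.e. $\mathrm{Dom}(\phi):=\{x:\phi(x)<+\infty\}\neq\emptyset$, and let $\lambda\in\mathbb{R}$. A *solution of $\mathrm{EVI}_\lambda$* is a continuous curve $u:(0,+\infty)\to\mathrm{Dom}(\phi)$ such that $$\frac12\,\frac{\mathrm d}{\mathrm dt}^{\!+} d^2(u_t,v)+\frac\lambda2\,d^2(u_t,v)\le\phi(v)-\phi(u_t)\qquad\text{for every }t>0,\ v\in\mathrm{Dom}(\phi),$$ where $\frac{\mathrm d}{\mathrm dt}^{\!+}\zeta(t):=\limsup_{h\downarrow0}\frac{\zeta(t+h)-\zeta(t)}h\in[-\infty,+\infty]$. It *starts from* $u_0\in X$ if $\lim_{t\downarrow0}u_t=u_0$; in this case its value at $t=0$ is understood to be $u_0$. An *$\mathrm{EVI}_\lambda$-gradient flow of $\phi$ in $D\subset\overline{\mathrm{Dom}(\phi)}$* is a family of continuous maps $\mathsf S_t:D\to D$, $t\ge0$, such that for every $u_0\in D$: $\mathsf S_{t+h}(u_0)=\mathsf S_h(\mathsf S_t(u_0))$ for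 all $t,h\ge0$; $\lim_{t\downarrow0}\mathsf S_t(u_0)=\mathsf S_0(u_0)=u_0$; and $t\mapsto\mathsf S_t(u_0)$ is a solution of $\mathrm{EVI}_\lambda$. **Corollary 3.7 (Construction of $\mathrm{EVI}_\lambda$-gradient flows).** Let $D_0\subset\overline{\mathrm{Dom}(\phi)}$ and suppose that for every $u_0\in D_0$ there exists a solution of $\mathrm{EVI}_\lambda$ starting from $u_0$. Set $$D:=\{u_t:\ t\ge0,\ u\text{ is a solution of }\mathrm{EVI}_\lambda\text{ starting from some }u_0\in D_0\}.$$ Then there exists a unique $\mathrm{EVI}_\lambda$-gradient flow $\mathsf S_t:D\to D$ of $\phi$ in $D$, and it satisfies the $\lambda$-contraction property $$d(\mathsf S_t(u_0),\mathsf S_t(v_0))\le e^{-\lambda t}\,d(u_0,v_0)\qquad\text{for every }u_0,v_0\in D,\ t\ge0.$$ If in addition $\phi$ has complete sublevels, i.e. $\{x:\phi(x)\le c\}$ is complete for every $c\in\mathbb{R}$ (in particular, this holds if $X$ is complete), then $\mathsf S$ extends by density, in a unique way, to an $\mathrm{EVI}_\lambda$-gradient flow of $\phi$ in $\overline D$.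 -/

import Mathlib

open Set Filter Topology
open scoped NNReal

/-- The proper domain `{x | φ x < +∞}` of an extended-real functional. -/
def properDomain {X : Type*} (φ : X → EReal) : Set X := {x | φ x < ⊤}

/-- The upper right Dini derivative `limsup_{h ↓ 0} (ζ (t + h) - ζ t) / h`, with values in
`[-∞, +∞]`. -/
noncomputable def upperRightDeriv (ζ : ℝ → ℝ) (t : ℝ) : EReal :=
  limsup (fun h : ℝ => (((ζ (t + h) - ζ t) / h : ℝ) : EReal)) (𝓝[>] 0)

/-- `u` is a solution of the Evolution Variational Inequality with parameter `lam` for `φ`: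
a continuous curve `(0, +∞) → Dom φ` such that
`(1/2) d⁺/dt d(u t, v)² + (lam/2) d(u t, v)² ≤ φ v - φ (u t)` for all `t > 0`, `v ∈ Dom φ`.
Curves on `(0, +∞)` are given by functions on `ℝ`; only the values at positive times matter
(all the points `t + h` used in the derivative at `t > 0` are positive). -/
structure IsEVISolution {X : Type*} [MetricSpace X] (φ : X → EReal) (lam : ℝ) (u : ℝ → X) :
    Prop where
  continuousOn : ContinuousOn u (Ioi 0)
  mem_domain : ∀ t : ℝ, 0 < t → u t ∈ properDomain φ
  evi : ∀ t : ℝ, 0 < t → ∀ v ∈ properDomain φ,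
    ((1 / 2 : ℝ) : EReal) * upperRightDeriv (fun s => dist (u s) v ^ 2) t
      + ((lam / 2 * dist (u t) v ^ 2 : ℝ) : EReal) ≤ φ v - φ (u t)

/-- `u` solves the EVI and starts from `u₀`: `lim_{t ↓ 0} u t = u₀`, with the value at time `0`
set equal to this limit. -/
structure IsEVISolutionFrom {X : Type*} [MetricSpace X] (φ : X → EReal) (lam : ℝ) (u₀ : X)
    (u : ℝ → X) : Prop where
  solution : IsEVISolution φ lam u
  initial : u 0 = u₀
  tendsto_zero : Tendsto u (𝓝[>] 0) (𝓝 u₀)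

/-- The union of the trajectories `{u t | t ≥ 0}` of the EVI solutions starting from points
of `D₀`. -/
def trajectoryUnion {X : Type*} [MetricSpace X] (φ : X → EReal) (lam : ℝ) (D₀ : Set X) : Set X :=
  {x | ∃ u₀ ∈ D₀, ∃ u : ℝ → X, IsEVISolutionFrom φ lam u₀ u ∧ ∃ t : ℝ, 0 ≤ t ∧ x = u t}

/-- `S` is an EVI gradient flow of `φ` in `D ⊆ closure (Dom φ)`, with parameter `lam`. -/
structure IsEVIGradientFlow {X : Type*} [MetricSpace X] (φ : X → EReal) (lam : ℝ) (D : Set X)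
    (S : ℝ≥0 → D → D) : Prop where
  subset_closure_domain : D ⊆ closure (properDomain φ)
  continuous_map : ∀ t, Continuous (S t)
  semigroup : ∀ (u₀ : D) (t h : ℝ≥0), S (t + h) u₀ = S h (S t u₀)
  zero : ∀ u₀ : D, S 0 u₀ = u₀
  tendsto_zero : ∀ u₀ : D, Tendsto (fun t : ℝ≥0 => S t u₀) (𝓝[>] 0) (𝓝 u₀)
  solution : ∀ u₀ : D, IsEVISolution φ lam (fun t : ℝ => (S t.toNNReal u₀ : X))

/-- All sublevels `{φ ≤ c}`, `c ∈ ℝ`, are complete. -/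
def HasCompleteSublevels {X : Type*} [MetricSpace X] (φ : X → EReal) : Prop :=
  ∀ c : ℝ, IsComplete {x : X | φ x ≤ (c : EReal)}

/-! The energy decreases along a solution, so Gronwall turns the inequality into the derivative-free
bound `EVIEstimate`. For continuous curves the two are equivalent (`isEVISolution_of_eviEstimate`),
and the integrated form survives limits in time and in the curve. Applying it to two solutions, each
tested against a point of the other, cancels the energies to first order and yields the contraction
`IsEVISolution.dist_sq_le`. Hence solutions are unique given their starting point, and shifting
trajectories in time gives the semigroup law. On the closure, contraction makes approximating
trajectories Cauchy, while the estimate from time `0` keeps them in one complete sublevel at each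
positive time. -/

/-! ### Gronwall bounds and Dini derivatives -/

theorem gronwallBound_eq_add (δ K ε x : ℝ) :
    gronwallBound δ K ε x = δ * Real.exp (K * x) + ε * gronwallBound 0 K 1 x := by
  rcases eq_or_ne K 0 with rfl | hK
  · simp [gronwallBound_K0]
  · simp only [gronwallBound_of_K_ne_0 hK]
    ring

theorem gronwallBound_zero_one_pos (K : ℝ) {x : ℝ} (hx : 0 < x) : 0 < gronwallBound 0 K 1 x := by
  rcases lt_trichotomy K 0 with hK | rfl | hK
  · simp only [gronwallBound_of_K_ne_0 hK.ne, zero_mul, zero_add]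
    refine mul_pos_of_neg_of_neg (div_neg_of_pos_of_neg one_pos hK) ?_
    have : Real.exp (K * x) < 1 := by
      simpa using mul_neg_of_neg_of_pos hK hx
    linarith
  · simpa [gronwallBound_K0] using hx
  · simp only [gronwallBound_of_K_ne_0 hK.ne', zero_mul, zero_add]
    refine mul_pos (by positivity) ?_
    have : 1 < Real.exp (K * x) := Real.one_lt_exp_iff.2 (mul_pos hK hx)
    linarith

theorem continuous_gronwallBound (δ K ε : ℝ) : Continuous (gronwallBound δ K ε) :=
  continuous_iff_continuousAt.2 fun x => (hasDerivAt_gronwallBound δ K ε x).continuousAt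

theorem tendsto_slope_gronwallBound (δ K ε : ℝ) :
    Tendsto (fun h => h⁻¹ * (gronwallBound δ K ε h - δ)) (𝓝[>] 0) (𝓝 (K * δ + ε)) := by
  have h := (hasDerivAt_gronwallBound δ K ε 0).tendsto_slope_zero_right
  simpa [gronwallBound_x0] using h

theorem map_sub_right_nhdsGT (t : ℝ) : map (fun z => z - t) (𝓝[>] t) = 𝓝[>] 0 := by
  simp [sub_eq_neg_add]

theorem tendsto_sub_right_nhdsGT (t : ℝ) : Tendsto (fun z => z - t) (𝓝[>] t) (𝓝[>] 0) :=
  (map_sub_right_nhdsGT t).le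

theorem upperRightDeriv_le_coe_iff {ζ : ℝ → ℝ} {t a : ℝ} :
    upperRightDeriv ζ t ≤ (a : EReal) ↔
      ∀ r, a < r → ∀ᶠ z in 𝓝[>] t, (z - t)⁻¹ * (ζ z - ζ t) < r := by
  unfold upperRightDeriv
  rw [limsup_le_iff, ← map_sub_right_nhdsGT t]
  simp only [eventually_map, add_sub_cancel]
  constructor
  · intro h r hr
    filter_upwards [h r (by exact_mod_cast hr)] with z hz
    rw [EReal.coe_lt_coe_iff] at hz
    rwa [inv_mul_eq_div]
  · intro h y hy
    obtain ⟨r, hr, hry⟩ := EReal.lt_iff_exists_real_btwn.1 hy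
    filter_upwards [h r (by exact_mod_cast hr)] with z hz
    refine lt_trans ?_ hry
    rw [EReal.coe_lt_coe_iff]
    rwa [← inv_mul_eq_div]

theorem half_mul_add_le_sub_iff (U : EReal) (b p q : ℝ) :
    ((1 / 2 : ℝ) : EReal) * U + (b : EReal) ≤ (p : EReal) - (q : EReal) ↔
      U ≤ ((2 * (p - q) - 2 * b : ℝ) : EReal) := by
  induction U with
  | bot => simp [EReal.coe_mul_bot_of_pos]
  | top =>
    rw [EReal.coe_mul_top_of_pos (by norm_num), EReal.top_add_coe]
    simp only [top_le_iff, EReal.coe_ne_top, iff_false]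
    rw [← EReal.coe_sub]
    exact EReal.coe_ne_top _
  | coe x =>
    norm_cast
    constructor <;> intro h <;> linarith

/-! ### The variational inequality and its integrated form -/

section

variable {X : Type*} {φ : X → EReal} {lam : ℝ}

theorem coe_toReal_of_mem_properDomain (hbot : ∀ x, φ x ≠ ⊥) {x : X} (hx : x ∈ properDomain φ) :
    ((φ x).toReal : EReal) = φ x :=
  EReal.coe_toReal (ne_of_lt hx) (hbot x)

theorem mem_properDomain_of_le_coe {x : X} {c : ℝ} (h : φ x ≤ (c : EReal)) :
    x ∈ properDomain φ :=
  h.trans_lt (EReal.coe_lt_top c)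

variable [MetricSpace X]

/-- The evolution variational inequality at a single time, as a bound on difference quotients. -/
theorem evi_iff_slope (hbot : ∀ x, φ x ≠ ⊥) {u : ℝ → X} {t : ℝ} {v : X}
    (hu : u t ∈ properDomain φ) (hv : v ∈ properDomain φ) :
    ((1 / 2 : ℝ) : EReal) * upperRightDeriv (fun s => dist (u s) v ^ 2) t
      + ((lam / 2 * dist (u t) v ^ 2 : ℝ) : EReal) ≤ φ v - φ (u t) ↔
    ∀ r, -lam * dist (u t) v ^ 2 + 2 * ((φ v).toReal - (φ (u t)).toReal) < r →
      ∀ᶠ z in 𝓝[>] t, (z - t)⁻¹ * (dist (u z) v ^ 2 - dist (u t) v ^ 2) < r := by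
  rw [← coe_toReal_of_mem_properDomain hbot hu, ← coe_toReal_of_mem_properDomain hbot hv,
    half_mul_add_le_sub_iff, upperRightDeriv_le_coe_iff, EReal.toReal_coe, EReal.toReal_coe]
  have : 2 * ((φ v).toReal - (φ (u t)).toReal) - 2 * (lam / 2 * dist (u t) v ^ 2) =
      -lam * dist (u t) v ^ 2 + 2 * ((φ v).toReal - (φ (u t)).toReal) := by ring
  rw [this]

/-- The Gronwall estimate for the squared distance, solved for the energy:
`φ (u t) ≤ φ v + (exp (-lam (t - s)) d(u s, v)² - d(u t, v)²) / (2 ∫₀^{t-s} exp (-lam r) dr)`. -/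
def EVIEstimate (φ : X → EReal) (lam : ℝ) (u : ℝ → X) (s t : ℝ) : Prop :=
  ∀ v ∈ properDomain φ, φ (u t) ≤ (((φ v).toReal +
    (dist (u s) v ^ 2 * Real.exp (-lam * (t - s)) - dist (u t) v ^ 2) /
      (2 * gronwallBound 0 (-lam) 1 (t - s)) : ℝ) : EReal)

theorem EVIEstimate.dist_sq_le {u : ℝ → X} {s t : ℝ} (h : EVIEstimate φ lam u s t)
    (hbot : ∀ x, φ x ≠ ⊥) (hst : s < t) {v : X} (hv : v ∈ properDomain φ) :
    dist (u t) v ^ 2 ≤ gronwallBound (dist (u s) v ^ 2) (-lam)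
      (2 * ((φ v).toReal - (φ (u t)).toReal)) (t - s) := by
  have h1 := h v hv
  rw [← coe_toReal_of_mem_properDomain hbot (mem_properDomain_of_le_coe h1),
    EReal.coe_le_coe_iff] at h1
  have hG := gronwallBound_zero_one_pos (-lam) (sub_pos.2 hst)
  rw [← sub_le_iff_le_add', le_div_iff₀ (by positivity)] at h1
  rw [gronwallBound_eq_add]
  linarith

/-- Let `a` be the last time in `[s, t]` with energy at most `φ (u s)`. After `a` the energy is at
least `φ (u a)`, so testing with `v = u a` and Gronwall freeze the curve at `u a` up to `t`. -/
theorem IsEVISolution.energy_antitone (hbot : ∀ x, φ x ≠ ⊥) (hlsc : LowerSemicontinuous φ)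
    {u : ℝ → X} (hu : IsEVISolution φ lam u) {s t : ℝ} (hs : 0 < s) (hst : s ≤ t) :
    φ (u t) ≤ φ (u s) := by
  have hcont : ContinuousOn u (Icc s t) :=
    hu.continuousOn.mono fun r hr => hs.trans_le hr.1
  set A : Set ℝ := Icc s t ∩ u ⁻¹' (φ ⁻¹' Iic (φ (u s))) with hA
  have hAc : IsCompact A :=
    isCompact_Icc.of_isClosed_subset
      (hcont.preimage_isClosed_of_isClosed isClosed_Icc (hlsc.isClosed_preimage _))
      inter_subset_left
  obtain ⟨a, ha, hmax⟩ := hAc.exists_isGreatest ⟨s, ⟨le_rfl, hst⟩, le_refl (φ (u s))⟩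
  have hapos : 0 < a := hs.trans_le ha.1.1
  have hage : ∀ x ∈ Ico a t, φ (u a) ≤ φ (u x) := by
    intro x hx
    rcases hx.1.eq_or_lt with rfl | hlt
    · rfl
    · by_contra hcon
      exact hlt.not_ge (hmax ⟨⟨ha.1.1.trans hx.1, hx.2.le⟩, (not_le.1 hcon).le.trans ha.2⟩)
  have hda : u a ∈ properDomain φ := hu.mem_domain a hapos
  have key := le_gronwallBound_of_liminf_deriv_right_le (f := fun r => dist (u r) (u a) ^ 2)
    (f' := fun r => -lam * dist (u r) (u a) ^ 2 + 2 * ((φ (u a)).toReal - (φ (u r)).toReal))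
    (δ := 0) (K := -lam) (ε := 0) (a := a) (b := t)
    ((continuous_dist.comp_continuousOn
      ((hcont.mono (Icc_subset_Icc_left ha.1.1)).prodMk continuousOn_const)).pow 2)
    (fun x hx r hr => ((evi_iff_slope hbot (hu.mem_domain x (hapos.trans_le hx.1)) hda).1
      (hu.evi x (hapos.trans_le hx.1) _ hda) r hr).frequently)
    (by simp)
    (fun x hx => by
      have := EReal.toReal_le_toReal (hage x hx) (hbot _)
        (ne_of_lt (hu.mem_domain x (hapos.trans_le hx.1)))
      linarith)
    t ⟨ha.1.2, le_rfl⟩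
  rw [gronwallBound_ε0_δ0] at key
  have h0 : u t = u a := dist_eq_zero.1 (pow_eq_zero_iff two_ne_zero |>.1
    (le_antisymm key (sq_nonneg _)))
  rw [h0]
  exact ha.2

theorem IsEVISolution.eviEstimate (hbot : ∀ x, φ x ≠ ⊥) (hlsc : LowerSemicontinuous φ)
    {u : ℝ → X} (hu : IsEVISolution φ lam u) {s t : ℝ} (hs : 0 < s) (hst : s < t) :
    EVIEstimate φ lam u s t := by
  intro v hv
  have key := le_gronwallBound_of_liminf_deriv_right_le (f := fun r => dist (u r) v ^ 2)
    (f' := fun r => -lam * dist (u r) v ^ 2 + 2 * ((φ v).toReal - (φ (u r)).toReal))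
    (δ := dist (u s) v ^ 2) (K := -lam) (ε := 2 * ((φ v).toReal - (φ (u t)).toReal))
    (a := s) (b := t)
    ((continuous_dist.comp_continuousOn
      ((hu.continuousOn.mono fun r (hr : r ∈ Icc s t) => hs.trans_le hr.1).prodMk
        continuousOn_const)).pow 2)
    (fun x (hx : x ∈ Ico s t) r hr => ((evi_iff_slope hbot (hu.mem_domain x (hs.trans_le hx.1)) hv).1
      (hu.evi x (hs.trans_le hx.1) _ hv) r hr).frequently)
    le_rfl
    (fun x hx => by
      have := EReal.toReal_le_toReal
        (hu.energy_antitone hbot hlsc (hs.trans_le hx.1) hx.2.le) (hbot _)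
        (ne_of_lt (hu.mem_domain x (hs.trans_le hx.1)))
      linarith)
    t ⟨hst.le, le_rfl⟩
  have hG := gronwallBound_zero_one_pos (-lam) (sub_pos.2 hst)
  rw [gronwallBound_eq_add] at key
  rw [← coe_toReal_of_mem_properDomain hbot (hu.mem_domain t (hs.trans hst)),
    EReal.coe_le_coe_iff, ← sub_le_iff_le_add', le_div_iff₀ (by positivity)]
  linarith

/-- A curve which is continuous at `0` inherits the estimate up to the initial time. -/
theorem IsEVISolutionFrom.eviEstimate (hbot : ∀ x, φ x ≠ ⊥) (hlsc : LowerSemicontinuous φ)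
    {u : ℝ → X} {u₀ : X} (hu : IsEVISolutionFrom φ lam u₀ u) {s t : ℝ} (hs : 0 ≤ s)
    (hst : s < t) : EVIEstimate φ lam u s t := by
  -- No energy at time `s` enters the estimate, so `s ↓ 0` is harmless even when the starting point
  -- has infinite energy.
  rcases hs.eq_or_lt with rfl | hs
  · intro v hv
    have hG := gronwallBound_zero_one_pos (-lam) hst
    have hid : Tendsto (fun s : ℝ => s) (𝓝[>] 0) (𝓝 0) := nhdsWithin_le_nhds
    have hsub : Tendsto (fun s : ℝ => t - s) (𝓝[>] 0) (𝓝 (t - 0)) := tendsto_const_nhds.sub hid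
    have hd : Tendsto (fun s => dist (u s) v ^ 2) (𝓝[>] 0) (𝓝 (dist (u 0) v ^ 2)) := by
      rw [hu.initial]
      exact (hu.tendsto_zero.dist tendsto_const_nhds).pow 2
    have hlim := (tendsto_const_nhds (x := (φ v).toReal)).add
      (((hd.mul ((hsub.const_mul (-lam)).rexp)).sub
        (tendsto_const_nhds (x := dist (u t) v ^ 2))).div
        ((((continuous_gronwallBound 0 (-lam) 1).tendsto (t - 0)).comp hsub).const_mul 2)
        (by rw [sub_zero]; positivity))
    refine ge_of_tendsto ((continuous_coe_real_ereal.tendsto _).comp hlim) ?_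
    filter_upwards [Ioo_mem_nhdsGT hst] with r hr
    exact hu.solution.eviEstimate hbot hlsc hr.1 hr.2 v hv
  · exact hu.solution.eviEstimate hbot hlsc hs hst

theorem isEVISolution_of_eviEstimate (hbot : ∀ x, φ x ≠ ⊥) (hne : (properDomain φ).Nonempty)
    (hlsc : LowerSemicontinuous φ) {u : ℝ → X} (hcont : ContinuousOn u (Ioi 0))
    (h : ∀ s t, 0 ≤ s → s < t → EVIEstimate φ lam u s t) : IsEVISolution φ lam u := by
  have hdom : ∀ t : ℝ, 0 < t → u t ∈ properDomain φ := fun t ht =>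
    mem_properDomain_of_le_coe (h 0 t le_rfl ht _ hne.some_mem)
  refine ⟨hcont, hdom, fun t ht v hv => (evi_iff_slope hbot (hdom t ht) hv).2 fun r hr => ?_⟩
  -- Lowering the energy by a quarter of the gap below `r` uses up half of that gap; lower
  -- semicontinuity then keeps `φ (u z)` above `c` for `z` near `t`.
  obtain ⟨c, hc, hcr⟩ : ∃ c, c < (φ (u t)).toReal ∧
      -lam * dist (u t) v ^ 2 + 2 * ((φ v).toReal - c) < r := by
    refine ⟨(φ (u t)).toReal -
      (r - (-lam * dist (u t) v ^ 2 + 2 * ((φ v).toReal - (φ (u t)).toReal))) / 4, ?_, ?_⟩ <;>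
    linarith
  have hev : ∀ᶠ z in 𝓝[>] t, (c : EReal) < φ (u z) := by
    have hut : Tendsto u (𝓝[>] t) (𝓝 (u t)) :=
      (hcont.continuousAt (Ioi_mem_nhds ht)).tendsto.mono_left nhdsWithin_le_nhds
    refine hut.eventually (hlsc (u t) c ?_)
    change (c : EReal) < φ (u t)
    rw [← coe_toReal_of_mem_properDomain hbot (hdom t ht)]
    exact_mod_cast hc
  have hB := ((tendsto_slope_gronwallBound (dist (u t) v ^ 2) (-lam)
    (2 * ((φ v).toReal - c))).comp (tendsto_sub_right_nhdsGT t)).eventually_lt_const hcr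
  filter_upwards [hev, hB, self_mem_nhdsWithin] with z hz hBz (htz : t < z)
  refine lt_of_le_of_lt ?_ hBz
  have hpos : 0 < z - t := sub_pos.2 htz
  have h1 := (h t z ht.le htz).dist_sq_le hbot htz hv
  have hG := gronwallBound_zero_one_pos (-lam) hpos
  rw [← coe_toReal_of_mem_properDomain hbot (hdom z (ht.trans htz)), EReal.coe_lt_coe_iff] at hz
  simp only [Function.comp]
  rw [gronwallBound_eq_add] at h1 ⊢
  refine mul_le_mul_of_nonneg_left ?_ (inv_nonneg.2 hpos.le)
  nlinarith

/-! ### Contraction and uniqueness -/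

theorem IsEVISolution.tendsto_energy (hbot : ∀ x, φ x ≠ ⊥) (hlsc : LowerSemicontinuous φ)
    {u : ℝ → X} (hu : IsEVISolution φ lam u) {t : ℝ} (ht : 0 < t) :
    Tendsto (fun z => (φ (u z)).toReal) (𝓝[>] t) (𝓝 (φ (u t)).toReal) := by
  have hut : Tendsto u (𝓝[>] t) (𝓝 (u t)) :=
    (hu.continuousOn.continuousAt (Ioi_mem_nhds ht)).tendsto.mono_left nhdsWithin_le_nhds
  refine (EReal.tendsto_toReal (ne_of_lt (hu.mem_domain t ht)) (hbot _)).comp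
    (tendsto_order.2 ⟨fun c hc => hut.eventually (hlsc (u t) c hc), fun c hc => ?_⟩)
  filter_upwards [self_mem_nhdsWithin] with z (hz : t < z)
  exact (hu.energy_antitone hbot hlsc ht hz.le).trans_lt hc

theorem IsEVISolution.dist_sq_le (hbot : ∀ x, φ x ≠ ⊥) (hlsc : LowerSemicontinuous φ)
    {u w : ℝ → X} (hu : IsEVISolution φ lam u) (hw : IsEVISolution φ lam w) {s t : ℝ}
    (hs : 0 < s) (hst : s ≤ t) :
    dist (u t) (w t) ^ 2 ≤ dist (u s) (w s) ^ 2 * Real.exp (-(2 * lam) * (t - s)) := by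
  rw [← gronwallBound_ε0]
  refine le_gronwallBound_of_liminf_deriv_right_le (f := fun r => dist (u r) (w r) ^ 2)
    (f' := fun r => -(2 * lam) * dist (u r) (w r) ^ 2)
    ((continuous_dist.comp_continuousOn
      ((hu.continuousOn.mono fun r (hr : r ∈ Icc s t) => hs.trans_le hr.1).prodMk
        (hw.continuousOn.mono fun r (hr : r ∈ Icc s t) => hs.trans_le hr.1))).pow 2)
    (fun x hx r hr => Eventually.frequently ?_) le_rfl
    (fun x hx => by simp) t ⟨hst, le_rfl⟩
  have hx0 : 0 < x := hs.trans_le hx.1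
  have hsub := tendsto_sub_right_nhdsGT x
  have hsub' : Tendsto (fun z => z - x) (𝓝[>] x) (𝓝 0) := hsub.mono_right nhdsWithin_le_nhds
  have h1 := ((tendsto_slope_gronwallBound 1 (-(2 * lam)) 0).comp hsub).const_mul
    (dist (u x) (w x) ^ 2)
  have h2 := (tendsto_slope_gronwallBound 0 (-lam) 1).comp hsub
  have he : Tendsto (fun z => Real.exp (-lam * (z - x))) (𝓝[>] x) (𝓝 (Real.exp (-lam * 0))) :=
    (hsub'.const_mul (-lam)).rexp
  have ha := hu.tendsto_energy hbot hlsc hx0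
  have hb := hw.tendsto_energy hbot hlsc hx0
  -- The bracket holds the energies left over from `e1` and `e2`; it tends to `0` by right
  -- continuity of the energy.
  have hlim := h1.add ((h2.const_mul 2).mul
    (((he.mul ((tendsto_const_nhds (x := (φ (u x)).toReal)).sub hb)).add hb).sub ha))
  have hlt := hlim.eventually_lt_const (u := r) (by
    simp only [mul_zero, Real.exp_zero]
    linarith)
  filter_upwards [hlt, self_mem_nhdsWithin] with z hz (hxz : x < z)
  refine lt_of_le_of_lt ?_ hz
  -- Move one curve at a time, from `(u x, w x)` through `(u x, w z)` to `(u z, w z)`.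
  have e1 := (hu.eviEstimate hbot hlsc hx0 hxz).dist_sq_le hbot hxz (hw.mem_domain z (hx0.trans hxz))
  have e2 := (hw.eviEstimate hbot hlsc hx0 hxz).dist_sq_le hbot hxz (hu.mem_domain x hx0)
  rw [dist_comm (w z), dist_comm (w x)] at e2
  rw [gronwallBound_eq_add] at e1 e2
  have e3 := mul_le_mul_of_nonneg_right e2 (Real.exp_pos (-lam * (z - x))).le
  have hpos : 0 < z - x := sub_pos.2 hxz
  have hexp : Real.exp (-(2 * lam) * (z - x)) =
      Real.exp (-lam * (z - x)) * Real.exp (-lam * (z - x)) := by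
    rw [← Real.exp_add]
    ring_nf
  simp only [Function.comp, gronwallBound_ε0, hexp]
  rw [← sub_nonneg]
  have : 0 ≤ (z - x)⁻¹ := inv_nonneg.2 hpos.le
  have e4 := mul_le_mul_of_nonneg_left (e1.trans (add_le_add_left e3 _)) this
  linarith

theorem IsEVISolution.dist_le (hbot : ∀ x, φ x ≠ ⊥) (hlsc : LowerSemicontinuous φ)
    {u w : ℝ → X} (hu : IsEVISolution φ lam u) (hw : IsEVISolution φ lam w) {s t : ℝ}
    (hs : 0 < s) (hst : s ≤ t) :
    dist (u t) (w t) ≤ Real.exp (-lam * (t - s)) * dist (u s) (w s) := by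
  refine (sq_le_sq₀ dist_nonneg (by positivity)).1
    ((hu.dist_sq_le hbot hlsc hw hs hst).trans_eq ?_)
  rw [mul_pow, ← Real.exp_nat_mul, mul_comm]
  congr 2
  push_cast
  ring

theorem IsEVISolutionFrom.dist_le (hbot : ∀ x, φ x ≠ ⊥) (hlsc : LowerSemicontinuous φ)
    {u w : ℝ → X} {u₀ w₀ : X} (hu : IsEVISolutionFrom φ lam u₀ u)
    (hw : IsEVISolutionFrom φ lam w₀ w) {t : ℝ} (ht : 0 ≤ t) :
    dist (u t) (w t) ≤ Real.exp (-lam * t) * dist u₀ w₀ := by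
  rcases ht.eq_or_lt with rfl | ht
  · simp [hu.initial, hw.initial]
  have hid : Tendsto (fun s : ℝ => s) (𝓝[>] 0) (𝓝 0) := nhdsWithin_le_nhds
  have hlim := ((((tendsto_const_nhds (x := t)).sub hid).const_mul (-lam)).rexp).mul
    (hu.tendsto_zero.dist hw.tendsto_zero)
  rw [sub_zero] at hlim
  refine ge_of_tendsto hlim ?_
  filter_upwards [Ioo_mem_nhdsGT ht] with s hs
  exact hu.solution.dist_le hbot hlsc hw.solution hs.1 hs.2.le

theorem IsEVISolutionFrom.eq_of_nonneg (hbot : ∀ x, φ x ≠ ⊥) (hlsc : LowerSemicontinuous φ)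
    {u w : ℝ → X} {u₀ : X} (hu : IsEVISolutionFrom φ lam u₀ u)
    (hw : IsEVISolutionFrom φ lam u₀ w) {t : ℝ} (ht : 0 ≤ t) : u t = w t := by
  have := hu.dist_le hbot hlsc hw ht
  rw [dist_self, mul_zero] at this
  exact dist_le_zero.1 this

/-! ### Time shifts and gradient flows -/

theorem upperRightDeriv_comp_const_add (ζ : ℝ → ℝ) (s t : ℝ) :
    upperRightDeriv (fun r => ζ (s + r)) t = upperRightDeriv ζ (s + t) := by
  simp only [upperRightDeriv, add_assoc]

theorem IsEVISolutionFrom.shift {u : ℝ → X} {u₀ : X} (hu : IsEVISolutionFrom φ lam u₀ u) {s : ℝ}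
    (hs : 0 ≤ s) : IsEVISolutionFrom φ lam (u s) (fun t => u (s + t)) := by
  refine ⟨⟨?_, fun t ht => hu.solution.mem_domain _ (by linarith), fun t ht v hv => ?_⟩,
    by simp, ?_⟩
  · exact hu.solution.continuousOn.comp (by fun_prop) fun t (ht : 0 < t) =>
      show 0 < s + t by linarith
  · rw [upperRightDeriv_comp_const_add (fun r => dist (u r) v ^ 2)]
    exact hu.solution.evi (s + t) (by linarith) v hv
  · rcases hs.eq_or_lt with rfl | hs
    · simpa [hu.initial] using hu.tendsto_zero
    · have h : ContinuousAt u (s + 0) := by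
        rw [add_zero]
        exact hu.solution.continuousOn.continuousAt (Ioi_mem_nhds hs)
      have h2 : ContinuousAt (fun t => u (s + t)) 0 :=
        ContinuousAt.comp (f := fun t : ℝ => s + t) h (by fun_prop)
      simpa using h2.tendsto.mono_left nhdsWithin_le_nhds

theorem IsEVIGradientFlow.isEVISolutionFrom {D : Set X} {S : ℝ≥0 → D → D}
    (hS : IsEVIGradientFlow φ lam D S) (x : D) :
    IsEVISolutionFrom φ lam (x : X) (fun t : ℝ => (S t.toNNReal x : X)) := by
  refine ⟨hS.solution x, by simp [hS.zero], ?_⟩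
  have h : Tendsto Real.toNNReal (𝓝[>] 0) (𝓝[>] 0) := by
    refine tendsto_nhdsWithin_iff.2 ⟨?_, ?_⟩
    · have := (continuous_real_toNNReal.tendsto (0 : ℝ)).mono_left
        (nhdsWithin_le_nhds (s := Ioi 0))
      simpa using this
    · filter_upwards [self_mem_nhdsWithin] with t (ht : 0 < t)
      exact Real.toNNReal_pos.2 ht
  exact (continuous_subtype_val.tendsto x).comp ((hS.tendsto_zero x).comp h)

theorem IsEVIGradientFlow.coe_eq (hbot : ∀ x, φ x ≠ ⊥) (hlsc : LowerSemicontinuous φ)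
    {D D' : Set X} {S : ℝ≥0 → D → D} {T : ℝ≥0 → D' → D'} (hS : IsEVIGradientFlow φ lam D S)
    (hT : IsEVIGradientFlow φ lam D' T) {x : D} {y : D'} (hxy : (x : X) = y) (t : ℝ≥0) :
    (S t x : X) = T t y := by
  have h := (hxy ▸ hS.isEVISolutionFrom x).eq_of_nonneg hbot hlsc (hT.isEVISolutionFrom y) t.2
  simpa using h

theorem IsEVIGradientFlow.unique (hbot : ∀ x, φ x ≠ ⊥) (hlsc : LowerSemicontinuous φ)
    {D : Set X} {S T : ℝ≥0 → D → D} (hS : IsEVIGradientFlow φ lam D S)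
    (hT : IsEVIGradientFlow φ lam D T) : S = T :=
  funext fun t => funext fun _ => Subtype.ext (hS.coe_eq hbot hlsc hT rfl t)

theorem IsEVIGradientFlow.dist_le (hbot : ∀ x, φ x ≠ ⊥) (hlsc : LowerSemicontinuous φ)
    {D : Set X} {S : ℝ≥0 → D → D} (hS : IsEVIGradientFlow φ lam D S) (t : ℝ≥0) (x y : D) :
    dist (S t x) (S t y) ≤ Real.exp (-lam * t) * dist x y := by
  simpa [Subtype.dist_eq] using (hS.isEVISolutionFrom x).dist_le hbot hlsc (hS.isEVISolutionFrom y) t.2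

theorem exists_isEVIGradientFlow (hbot : ∀ x, φ x ≠ ⊥) (hlsc : LowerSemicontinuous φ)
    {D : Set X} (hD : D ⊆ closure (properDomain φ))
    (h : ∀ x ∈ D, ∃ u : ℝ → X, IsEVISolutionFrom φ lam x u ∧ ∀ t, 0 ≤ t → u t ∈ D) :
    ∃ S : ℝ≥0 → D → D, IsEVIGradientFlow φ lam D S := by
  choose! u hu huD using h
  have hle : ∀ (t : ℝ≥0) (x y : D),
      dist (u x t) (u y t) ≤ Real.exp (-lam * t) * dist (x : X) y := fun t x y =>
    (hu x x.2).dist_le hbot hlsc (hu y y.2) t.2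
  refine ⟨fun t x => ⟨u x t, huD x x.2 t t.2⟩, hD, fun t => ?_, fun x t r => ?_, fun x => ?_,
    fun x => ?_, fun x => ?_⟩
  · exact (LipschitzWith.of_dist_le_mul (K := (Real.exp (-lam * t)).toNNReal) fun x y => by
      rw [Real.coe_toNNReal _ (Real.exp_pos _).le]
      exact hle t x y).continuous
  · refine Subtype.ext ?_
    -- The shifted curve and the curve chosen at `u x t` share their starting point, hence coincide.
    have h1 := ((hu x x.2).shift t.2).eq_of_nonneg hbot hlsc (hu _ (huD x x.2 t t.2)) r.2
    simpa using h1
  · exact Subtype.ext (by simpa using (hu x x.2).initial)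
  · rw [tendsto_subtype_rng]
    refine (hu x x.2).tendsto_zero.comp (tendsto_nhdsWithin_iff.2 ⟨?_, ?_⟩)
    · exact (NNReal.continuous_coe.tendsto 0).mono_left nhdsWithin_le_nhds
    · filter_upwards [self_mem_nhdsWithin] with t (ht : 0 < t)
      exact NNReal.coe_pos.2 ht
  · have hsol := (hu x x.2).solution
    have heq : ∀ t : ℝ, 0 < t → u x (t.toNNReal : ℝ) = u x t := fun t ht => by
      rw [Real.coe_toNNReal _ ht.le]
    refine ⟨hsol.continuousOn.congr fun t ht => heq t ht, fun t ht => ?_, fun t ht v hv => ?_⟩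
    · simpa only [heq t ht] using hsol.mem_domain t ht
    · have h2 : upperRightDeriv (fun s : ℝ => dist (u x (s.toNNReal : ℝ)) v ^ 2) t =
          upperRightDeriv (fun s => dist (u x s) v ^ 2) t := by
        refine limsup_congr ?_
        filter_upwards [self_mem_nhdsWithin] with r (hr : 0 < r)
        rw [heq t ht, heq (t + r) (by linarith)]
      simp only [h2, heq t ht]
      exact hsol.evi t ht v hv

/-! ### Extension to the closure -/

theorem IsEVISolutionFrom.continuousOn_Ici {u : ℝ → X} {u₀ : X}
    (hu : IsEVISolutionFrom φ lam u₀ u) : ContinuousOn u (Ici 0) := by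
  intro t ht
  rcases (mem_Ici.1 ht).eq_or_lt with rfl | ht
  · rw [← continuousWithinAt_Ioi_iff_Ici, ContinuousWithinAt, hu.initial]
    exact hu.tendsto_zero
  · exact (hu.solution.continuousOn.continuousAt (Ioi_mem_nhds ht)).continuousWithinAt

/-- The estimate passes to pointwise limits of curves. -/
theorem EVIEstimate.of_tendsto (hlsc : LowerSemicontinuous φ) {U : ℕ → ℝ → X} {u : ℝ → X}
    {s t : ℝ} (h : ∀ n, EVIEstimate φ lam (U n) s t)
    (hs : Tendsto (fun n => U n s) atTop (𝓝 (u s)))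
    (ht : Tendsto (fun n => U n t) atTop (𝓝 (u t))) : EVIEstimate φ lam u s t := by
  intro v hv
  have hlim := (tendsto_const_nhds (x := (φ v).toReal)).add
    (((((hs.dist (tendsto_const_nhds (x := v))).pow 2).mul_const (Real.exp (-lam * (t - s)))).sub
      ((ht.dist (tendsto_const_nhds (x := v))).pow 2)).div_const
        (2 * gronwallBound 0 (-lam) 1 (t - s)))
  refine le_of_forall_lt_imp_le_of_dense fun a ha => ?_
  refine ge_of_tendsto ((continuous_coe_real_ereal.tendsto _).comp hlim) ?_
  filter_upwards [ht.eventually (hlsc (u t) a ha)] with n hn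
  exact (le_of_lt hn).trans (h n v hv)

theorem IsEVIGradientFlow.exists_isEVISolutionFrom_of_mem_closure (hbot : ∀ x, φ x ≠ ⊥)
    (hne : (properDomain φ).Nonempty) (hlsc : LowerSemicontinuous φ)
    (hcompl : HasCompleteSublevels φ) {D : Set X} {S : ℝ≥0 → D → D}
    (hS : IsEVIGradientFlow φ lam D S) {x : X} (hx : x ∈ closure D) :
    ∃ u : ℝ → X, IsEVISolutionFrom φ lam x u ∧ ∀ t, 0 ≤ t → u t ∈ closure D := by
  obtain ⟨y', hy'D, hy⟩ := mem_closure_iff_seq_limit.1 hx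
  lift y' to ℕ → D using hy'D with y
  have hyC : CauchySeq y := (isUniformInducing_val D).cauchy_map_iff.1 hy.cauchySeq
  set U : ℕ → ℝ → X := fun n t => S t.toNNReal (y n) with hU
  have hUsol : ∀ n, IsEVISolutionFrom φ lam (y n : X) (U n) := fun n => hS.isEVISolutionFrom (y n)
  have hUC : ∀ t, CauchySeq fun n => U n t := fun t => by
    have hL : LipschitzWith (Real.exp (-lam * t.toNNReal)).toNNReal
        (fun z : D => (S t.toNNReal z : X)) :=
      LipschitzWith.of_dist_le_mul fun z w => by
        rw [Real.coe_toNNReal _ (Real.exp_pos _).le]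
        exact hS.dist_le hbot hlsc _ z w
    exact hL.cauchySeq_comp hyC
  obtain ⟨v, hv⟩ := hne
  have hex : ∀ t : ℝ, ∃ z, Tendsto (fun n => U n t) atTop (𝓝 z) := fun t => by
    rcases le_or_gt t 0 with ht | ht
    · refine ⟨x, ?_⟩
      simpa [hU, Real.toNNReal_of_nonpos ht, hS.zero] using hy
    · have hlim := (tendsto_const_nhds (x := (φ v).toReal)).add
        (((((hy.dist (tendsto_const_nhds (x := v))).pow 2).mul_const
          (Real.exp (-lam * (t - 0))))).div_const (2 * gronwallBound 0 (-lam) 1 (t - 0)))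
      -- `M` bounds the right side of the estimate from time `0`, without its negative term,
      -- uniformly in `n`.
      obtain ⟨M, hM⟩ := hlim.bddAbove_range
      have hG := gronwallBound_zero_one_pos (-lam) (sub_pos.2 ht)
      have hmem : ∀ n, U n t ∈ {z | φ z ≤ (M : EReal)} := fun n => by
        refine ((hUsol n).eviEstimate hbot hlsc le_rfl ht v hv).trans
          (EReal.coe_le_coe_iff.2 (le_trans ?_ (hM ⟨n, rfl⟩)))
        rw [(hUsol n).initial]
        beta_reduce
        gcongr
        exact sub_le_self _ (sq_nonneg _)
      obtain ⟨z, -, hz⟩ := cauchySeq_tendsto_of_isComplete (hcompl M) hmem (hUC t)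
      exact ⟨z, hz⟩
  choose u hu using hex
  have hu0 : u 0 = x := tendsto_nhds_unique (hu 0) (by simpa [hU, hS.zero] using hy)
  have hdist : ∀ n t, 0 ≤ t → dist (u t) (U n t) ≤ Real.exp (-lam * t) * dist x (y n) :=
    fun n t ht => le_of_tendsto_of_tendsto' ((hu t).dist tendsto_const_nhds)
      ((hy.dist tendsto_const_nhds).const_mul _)
      fun m => (hUsol m).dist_le hbot hlsc (hUsol n) ht
  have hloc : TendstoLocallyUniformlyOn U u atTop (Ici 0) := by
    refine Metric.tendstoLocallyUniformlyOn_iff.2 fun ε hε t _ => ?_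
    refine ⟨Iio (t + 1) ∩ Ici 0,
      inter_mem (mem_nhdsWithin_of_mem_nhds (Iio_mem_nhds (lt_add_one t))) self_mem_nhdsWithin, ?_⟩
    have hlim : Tendsto (fun n => Real.exp (|lam| * (t + 1)) * dist x (y n)) atTop (𝓝 0) := by
      simpa using ((tendsto_const_nhds (x := x)).dist hy).const_mul (Real.exp (|lam| * (t + 1)))
    filter_upwards [hlim.eventually_lt_const hε] with n hn r hr
    refine ((hdist n r hr.2).trans ?_).trans_lt hn
    gcongr ?_ * _
    refine Real.exp_le_exp.2 ?_
    have hr0 : 0 ≤ r := hr.2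
    exact mul_le_mul (neg_le_abs lam) (le_of_lt hr.1) hr0 (abs_nonneg _)
  have hcont : ContinuousOn u (Ici 0) :=
    hloc.continuousOn (Eventually.of_forall fun n => (hUsol n).continuousOn_Ici).frequently
  refine ⟨u, ⟨isEVISolution_of_eviEstimate hbot ⟨v, hv⟩ hlsc (hcont.mono Ioi_subset_Ici_self)
    fun s t hs hst => ?_, hu0, ?_⟩, fun t _ => ?_⟩
  · exact EVIEstimate.of_tendsto hlsc
      (fun n => (hUsol n).eviEstimate hbot hlsc hs hst) (hu s) (hu t)
  · rw [← hu0]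
    exact (hcont 0 self_mem_Ici).tendsto.mono_left (nhdsWithin_mono _ Ioi_subset_Ici_self)
  · exact mem_closure_of_tendsto (hu t) (Eventually.of_forall fun n => Subtype.coe_prop _)

/-! ### The union of trajectories and the conclusion -/

theorem trajectoryUnion_subset_closure {D₀ : Set X} (hD₀ : D₀ ⊆ closure (properDomain φ)) :
    trajectoryUnion φ lam D₀ ⊆ closure (properDomain φ) := by
  rintro x ⟨u₀, hu₀, u, hu, t, ht, rfl⟩
  rcases ht.eq_or_lt with rfl | ht
  · rw [hu.initial]
    exact hD₀ hu₀
  · exact subset_closure (hu.solution.mem_domain t ht)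

theorem exists_isEVISolutionFrom_of_mem_trajectoryUnion {D₀ : Set X} {x : X}
    (hx : x ∈ trajectoryUnion φ lam D₀) :
    ∃ u : ℝ → X, IsEVISolutionFrom φ lam x u ∧ ∀ t, 0 ≤ t → u t ∈ trajectoryUnion φ lam D₀ := by
  obtain ⟨u₀, hu₀, u, hu, s, hs, rfl⟩ := hx
  exact ⟨fun t => u (s + t), hu.shift hs, fun t ht => ⟨u₀, hu₀, u, hu, s + t, by positivity, rfl⟩⟩

end

theorem corollary3p7 {X : Type*} [MetricSpace X] (φ : X → EReal)
    (hφ_bot : ∀ x, φ x ≠ ⊥) (hφ_proper : (properDomain φ).Nonempty)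
    (hφ_lsc : LowerSemicontinuous φ) (lam : ℝ) (D₀ : Set X)
    (hD₀ : D₀ ⊆ closure (properDomain φ))
    (hex : ∀ u₀ ∈ D₀, ∃ u : ℝ → X, IsEVISolutionFrom φ lam u₀ u) :
    ∃ S : ℝ≥0 → trajectoryUnion φ lam D₀ → trajectoryUnion φ lam D₀,
      IsEVIGradientFlow φ lam (trajectoryUnion φ lam D₀) S ∧
      (∀ S' : ℝ≥0 → trajectoryUnion φ lam D₀ → trajectoryUnion φ lam D₀,
        IsEVIGradientFlow φ lam (trajectoryUnion φ lam D₀) S' → S' = S) ∧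
      (∀ (t : ℝ≥0) (u₀ v₀ : trajectoryUnion φ lam D₀),
        dist (S t u₀) (S t v₀) ≤ Real.exp (-lam * t) * dist u₀ v₀) ∧
      (CompleteSpace X → HasCompleteSublevels φ) ∧
      (HasCompleteSublevels φ →
        ∃! T : ℝ≥0 → closure (trajectoryUnion φ lam D₀) → closure (trajectoryUnion φ lam D₀),
          IsEVIGradientFlow φ lam (closure (trajectoryUnion φ lam D₀)) T ∧
          ∀ (t : ℝ≥0) (u₀ : trajectoryUnion φ lam D₀),
            (T t ⟨u₀, subset_closure u₀.2⟩ : X) = S t u₀) := by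
  obtain ⟨S, hS⟩ := exists_isEVIGradientFlow hφ_bot hφ_lsc
    (trajectoryUnion_subset_closure (lam := lam) hD₀)
    fun x hx => exists_isEVISolutionFrom_of_mem_trajectoryUnion hx
  refine ⟨S, hS, fun S' hS' => hS'.unique hφ_bot hφ_lsc hS, hS.dist_le hφ_bot hφ_lsc,
    fun _ c => (hφ_lsc.isClosed_preimage (c : EReal)).isComplete, fun hcompl => ?_⟩
  obtain ⟨T, hT⟩ := exists_isEVIGradientFlow hφ_bot hφ_lsc
    (closure_minimal hS.subset_closure_domain isClosed_closure)
    fun x hx => hS.exists_isEVISolutionFrom_of_mem_closure hφ_bot hφ_proper hφ_lsc hcompl hx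
  -- Uniqueness of solutions already forces any flow on the closure to extend `S`.
  exact ⟨T, ⟨hT, fun t u₀ => hT.coe_eq hφ_bot hφ_lsc hS rfl t⟩,
    fun T' hT' => hT'.1.unique hφ_bot hφ_lsc hT⟩
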